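/- Let $d,u\ge 1$ and $m\ge 2$, and let $\mathcal E_1,\dots,\mathcal E_m$ be quantum channels from a $d$-dimensional system to a $d'$-dimensional system that are jointly teleportation-covariant: for every generalized Pauli unitary $U=X^aZ^b$ of dimension $d$ there is a unitary $V$, the same for all $n$, with $\mathcal E_n(U\rho U^\dagger)=V\mathcal E_n(\rho)V^\dagger$ for all states $\rho$ and all $n$. Let $P_1,\dots,P_m\ge 0$ with $\sum_n P_n=1$ be prior probabilities and $\epsilon_1,\dots,\epsilon_m\ge 0$ error tolerances. For states $\rho_1,\dots,\rho_m$ and a POVM $\{\Pi_k\}_{k=0}^m$ (outcome $0$ is inconclusive) put $P_F=\sum_n P_n\operatorname{tr}(\rho_n\Pi_0)$ and $P_{E|n}=1-\operatorname{tr}(\rho_n\Pi_n)-\operatorname{tr}(\rho_n\Pi_0)$. Let $P_F^{U\star}(\epsilon;\{\rho_n,P_n\})$ be the minimum of $P_F$ over the POVMs with $P_{E|n}\le\epsilon_n$ for all $n$, and let $P_F^{R\star}(\epsilon;\{\rho_n,P_n\})$ be its minimum under the rescaled constraints $P_{E|n}/(1-P_F)\le\epsilon_n$ for all $n$, read as $P_{E|n}\le\epsilon_n(1-P_F)$.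 Let $P_{F,u}^{X\star}(\epsilon;\{\mathcal E_n,P_n\})$, $X\in\{U,R\}$, be the minimum of $P_F$ under the same constraints over all $u$-round adaptive protocols: an arbitrary initial state of a probe and a finite-dimensional ancilla; $u$ uses of the unknown channel on the probe, interleaved with arbitrary quantum operations that act on everything collected so far and produce the next probe and ancilla; and a final POVM on the output state. Let $|\zeta\rangle=d^{-1/2}\sum_{\ell=0}^{d-1}|\ell,\ell\rangle$, $\zeta=|\zeta\rangle\langle\zeta|$, and let $\rho_{\mathcal E_n}=(\mathcal E_n\otimes\mathcal I)(\zeta)$ be the Choi states. Then for $X=U$ and for $X=R$ these minima exist and $$P_{F,u}^{X\star}(\epsilon;\{\mathcal E_n,P_n\})=P_F^{X\star}(\epsilon;\{\rho_{\mathcal E_n}^{\otimes u},P_n\}).$$ Moreover this value is achieved by the non-adaptive strategy that sends $u$ copies of $\zeta$ through $u$ copies of the extended channel $\mathcal E_n\otimes\mathcal I$ and measures the output with a suitable POVM; up to relabelling of the output systems, this strategy is one of the $u$-round adaptive protocols. -/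

import Mathlib

open scoped ComplexOrder

noncomputable section

namespace ChannelUD

/-- Density operators on the space with orthonormal basis indexed by `ι`. -/
def IsState {ι : Type} [Fintype ι] (ρ : Matrix ι ι ℂ) : Prop :=
  ρ.PosSemidef ∧ ρ.trace = 1

/-- The extension `Φ ⊗ id` of a linear map `Φ` by an ancilla with basis `κ`:
`Φ` acts on each of the blocks of the matrix that are labelled by the ancilla. -/
def extend {ι ι' : Type} (Φ : Matrix ι ι ℂ →ₗ[ℂ] Matrix ι' ι' ℂ) (κ : Type) :
    Matrix (ι × κ) (ι × κ) ℂ →ₗ[ℂ] Matrix (ι' × κ) (ι' × κ) ℂ where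
  toFun X := Matrix.of fun p q =>
    Φ (Matrix.of fun i j => X (i, p.2) (j, q.2)) p.1 q.1
  map_add' X Y := by
    ext p q
    exact congrFun (congrFun (Φ.map_add (Matrix.of fun i j => X (i, p.2) (j, q.2))
      (Matrix.of fun i j => Y (i, p.2) (j, q.2))) p.1) q.1
  map_smul' c X := by
    ext p q
    exact congrFun (congrFun (Φ.map_smul c (Matrix.of fun i j => X (i, p.2) (j, q.2))) p.1) q.1

/-- Quantum channels: completely positive trace-preserving linear maps. -/
def IsChannel {ι ι' : Type} [Fintype ι] [Fintype ι']
    (Φ : Matrix ι ι ℂ →ₗ[ℂ] Matrix ι' ι' ℂ) : Prop :=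
  (∀ (r : ℕ) (X : Matrix (ι × Fin r) (ι × Fin r) ℂ),
      X.PosSemidef → (extend Φ (Fin r) X).PosSemidef) ∧
    ∀ X : Matrix ι ι ℂ, (Φ X).trace = X.trace

/-- The `u`-fold tensor power of an operator. -/
def tensorPow {ι : Type} (ρ : Matrix ι ι ℂ) (u : ℕ) :
    Matrix (Fin u → ι) (Fin u → ι) ℂ :=
  Matrix.of fun i j => ∏ t, ρ (i t) (j t)

/-- The `u`-fold tensor power `Φ ⊗ ⋯ ⊗ Φ` of a linear map, given on an operator by expanding
the operator in products of matrix units. -/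
def mapTensorPow {ι ι' : Type} [Fintype ι] [DecidableEq ι]
    (Φ : Matrix ι ι ℂ →ₗ[ℂ] Matrix ι' ι' ℂ) (u : ℕ)
    (X : Matrix (Fin u → ι) (Fin u → ι) ℂ) : Matrix (Fin u → ι') (Fin u → ι') ℂ :=
  ∑ k : Fin u → ι, ∑ l : Fin u → ι,
    X k l • Matrix.of fun i j => ∏ t, Φ (Matrix.single (k t) (l t) 1) (i t) (j t)

/-- The vector `|ζ⟩ = ∑ ℓ, |ℓ, ℓ⟩ / √d`. -/
def maxEntKet (d : ℕ) : Fin d × Fin d → ℂ :=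
  fun p => if p.1 = p.2 then ((Real.sqrt d : ℝ) : ℂ)⁻¹ else 0

/-- The maximally entangled state `ζ = |ζ⟩⟨ζ|`. -/
def maxEnt (d : ℕ) : Matrix (Fin d × Fin d) (Fin d × Fin d) ℂ :=
  Matrix.vecMulVec (maxEntKet d) (star (maxEntKet d))

/-- The Choi state `(Φ ⊗ id)(ζ)`. -/
def choiState {d d' : ℕ}
    (Φ : Matrix (Fin d) (Fin d) ℂ →ₗ[ℂ] Matrix (Fin d') (Fin d') ℂ) :
    Matrix (Fin d' × Fin d) (Fin d' × Fin d) ℂ :=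
  extend Φ (Fin d) (maxEnt d)

/-- Output of the non-adaptive strategy that sends `u` copies of `ζ` through `u` copies
of the extended channel `Φ ⊗ id`. -/
def parallelOutput {d d' : ℕ}
    (Φ : Matrix (Fin d) (Fin d) ℂ →ₗ[ℂ] Matrix (Fin d') (Fin d') ℂ) (u : ℕ) :
    Matrix (Fin u → Fin d' × Fin d) (Fin u → Fin d' × Fin d) ℂ :=
  mapTensorPow (extend Φ (Fin d)) u (tensorPow (maxEnt d) u)

/-- The generalized Pauli unitary `X ^ a * Z ^ b` of dimension `d`, with shift
`X |j⟩ = |j + 1 mod d⟩` and clock `Z |j⟩ = exp (2 π i j / d) |j⟩`. -/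
def pauli (d : ℕ) (a b : Fin d) : Matrix (Fin d) (Fin d) ℂ :=
  Matrix.of fun i j =>
    if i = j + a then
      Complex.exp (2 * Real.pi * Complex.I * ((b : ℕ) : ℂ) * ((j : ℕ) : ℂ) / (d : ℂ))
    else 0

/-- Joint teleportation covariance: for each Pauli unitary `U` there is one unitary `V`, the same
for all channels of the family, with `E n (U ρ U†) = V (E n ρ) V†` for all states `ρ`. -/
def JointlyTeleportationCovariant {d d' m : ℕ}
    (E : Fin m → (Matrix (Fin d) (Fin d) ℂ →ₗ[ℂ] Matrix (Fin d') (Fin d') ℂ)) : Prop :=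
  ∀ a b : Fin d, ∃ V ∈ Matrix.unitaryGroup (Fin d') ℂ,
    ∀ (n : Fin m) (ρ : Matrix (Fin d) (Fin d) ℂ), IsState ρ →
      E n (pauli d a b * ρ * (pauli d a b).conjTranspose) = V * E n ρ * V.conjTranspose

/-- POVMs with outcomes `0, …, m`; outcome `0` is the inconclusive one, and outcome `n.succ`
is the decision for hypothesis `n : Fin m`. -/
def IsPOVM {ι : Type} [Fintype ι] [DecidableEq ι] {m : ℕ}
    (M : Fin (m + 1) → Matrix ι ι ℂ) : Prop :=
  (∀ k, (M k).PosSemidef) ∧ ∑ k, M k = 1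

/-- The overall inconclusive probability `P_F`. -/
def inconclusiveProb {ι : Type} [Fintype ι] {m : ℕ} (ρ : Fin m → Matrix ι ι ℂ)
    (P : Fin m → ℝ) (M : Fin (m + 1) → Matrix ι ι ℂ) : ℝ :=
  ∑ n, P n * (ρ n * M 0).trace.re

/-- The conditional conclusive error probability `P_{E|n}`. -/
def errorProb {ι : Type} [Fintype ι] {m : ℕ} (ρ : Fin m → Matrix ι ι ℂ)
    (M : Fin (m + 1) → Matrix ι ι ℂ) (n : Fin m) : ℝ :=
  1 - ((ρ n * M n.succ).trace.re + (ρ n * M 0).trace.re)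

/-- The two kinds of error constraints. -/
inductive ConstraintKind
  | unrescaled
  | rescaled

/-- The error constraints with tolerances `ε`: `P_{E|n} ≤ ε n` in the unrescaled case and
`P_{E|n} / (1 - P_F) ≤ ε n` in the rescaled case. The denominator is cleared in the latter, so that
the measurement that is always inconclusive (`P_F = 1`) is admissible. -/
def Meets {ι : Type} [Fintype ι] {m : ℕ} (X : ConstraintKind) (ε : Fin m → ℝ)
    (ρ : Fin m → Matrix ι ι ℂ) (P : Fin m → ℝ) (M : Fin (m + 1) → Matrix ι ι ℂ) : Prop :=
  match X with
  | .unrescaled => ∀ n, errorProb ρ M n ≤ ε n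
  | .rescaled => ∀ n, errorProb ρ M n ≤ ε n * (1 - inconclusiveProb ρ P M)

/-- Inconclusive probabilities of the measurements on the ensemble `{ρ, P}` that meet the
constraints. -/
def stateValues {ι : Type} [Fintype ι] [DecidableEq ι] {m : ℕ} (X : ConstraintKind)
    (ε : Fin m → ℝ) (ρ : Fin m → Matrix ι ι ℂ) (P : Fin m → ℝ) : Set ℝ :=
  {p | ∃ M : Fin (m + 1) → Matrix ι ι ℂ,
    IsPOVM M ∧ Meets X ε ρ P M ∧ inconclusiveProb ρ P M = p}

/-- The minimum inconclusive probability for an ensemble of states. -/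
def stateOpt {ι : Type} [Fintype ι] [DecidableEq ι] {m : ℕ} (X : ConstraintKind)
    (ε : Fin m → ℝ) (ρ : Fin m → Matrix ι ι ℂ) (P : Fin m → ℝ) : ℝ :=
  sInf (stateValues X ε ρ P)

/-- Adaptive protocols for probing a channel with input dimension `d` and output dimension `d'`.
The `k`-th use (`k = 0, 1, …`) acts on a probe that may be entangled with an ancillary system
with basis `anc k`, of arbitrary finite dimension. Between two uses an arbitrary quantum operation
acts on everything collected so far and produces the next probe and the next ancilla;
fresh ancillas, measurements and feed-forward are all of this form. A protocol of `u` rounds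
uses only the operations `op k` with `k + 1 < u`. -/
structure AdaptiveProtocol (d d' : ℕ) where
  anc : ℕ → Type
  [ancFintype : ∀ k, Fintype (anc k)]
  [ancDecEq : ∀ k, DecidableEq (anc k)]
  init : Matrix (Fin d × anc 0) (Fin d × anc 0) ℂ
  init_isState : IsState init
  op : ∀ k, Matrix (Fin d' × anc k) (Fin d' × anc k) ℂ →ₗ[ℂ]
    Matrix (Fin d × anc (k + 1)) (Fin d × anc (k + 1)) ℂ
  op_isChannel : ∀ k, IsChannel (op k)

attribute [instance] AdaptiveProtocol.ancFintype AdaptiveProtocol.ancDecEq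

/-- The joint state of probe and ancilla just before the use number `k` (counted from `0`) of the
channel `Φ`. -/
def AdaptiveProtocol.probe {d d' : ℕ} (A : AdaptiveProtocol d d')
    (Φ : Matrix (Fin d) (Fin d) ℂ →ₗ[ℂ] Matrix (Fin d') (Fin d') ℂ) :
    ∀ k, Matrix (Fin d × A.anc k) (Fin d × A.anc k) ℂ
  | 0 => A.init
  | k + 1 => A.op k (extend Φ (A.anc k) (A.probe Φ k))

/-- The output state of the protocol after `u ≥ 1` uses of `Φ`. -/
def AdaptiveProtocol.output {d d' : ℕ} (A : AdaptiveProtocol d d')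
    (Φ : Matrix (Fin d) (Fin d) ℂ →ₗ[ℂ] Matrix (Fin d') (Fin d') ℂ) (u : ℕ) :
    Matrix (Fin d' × A.anc (u - 1)) (Fin d' × A.anc (u - 1)) ℂ :=
  extend Φ (A.anc (u - 1)) (A.probe Φ (u - 1))

/-- Inconclusive probabilities of the `u`-round adaptive protocols, each with a final measurement
of its output, that meet the constraints. -/
def adaptiveValues {d d' m : ℕ} (X : ConstraintKind) (ε : Fin m → ℝ)
    (E : Fin m → (Matrix (Fin d) (Fin d) ℂ →ₗ[ℂ] Matrix (Fin d') (Fin d') ℂ))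
    (P : Fin m → ℝ) (u : ℕ) : Set ℝ :=
  {p | ∃ A : AdaptiveProtocol d d', p ∈ stateValues X ε (fun n => A.output (E n) u) P}

/-- The minimum inconclusive probability of `u`-round adaptive channel discrimination. -/
def adaptiveOpt {d d' m : ℕ} (X : ConstraintKind) (ε : Fin m → ℝ)
    (E : Fin m → (Matrix (Fin d) (Fin d) ℂ →ₗ[ℂ] Matrix (Fin d') (Fin d') ℂ))
    (P : Fin m → ℝ) (u : ℕ) : ℝ :=
  sInf (adaptiveValues X ε E P u)

end ChannelUD

end

/-! The argument is teleportation stretching. Teleporting a probe through the Choi state of `E n`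
applies `E n` to the probe conjugated by a Pauli unitary `U` known from the Bell outcome. By
covariance this error leaves the channel as a unitary `V` that does not depend on `n`, so it can be
undone without knowing `n`. Hence one fixed channel turns an input and one Choi state into the
output of `E n` (`exists_teleportation`), and by induction on the rounds the output of any adaptive
protocol is `Λ` applied to the `u`-th tensor power of the Choi state, with `Λ` independent of `n`
(`exists_simulation_probe`, `exists_simulation_extend`).

Pulling the final POVM back through `Λ` preserves every outcome probability, hence `P_F` and both
kinds of constraint (`stateValues_subset_of_map`). Conversely, `parallelProtocol` produces the
tensor power itself, up to relabelling. So the sets of attainable values coincide, not merely their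
infima; the minimum exists because the POVMs form a compact set. -/

noncomputable section

namespace ChannelUD

open Matrix
open scoped Kronecker

/-! ### Positive semidefinite matrices -/

section Positivity

variable {ι κ : Type} [Fintype ι] [Fintype κ]

theorem _root_.Matrix.PosSemidef.exists_eq_conjTranspose_mul_self {A : Matrix ι ι ℂ}
    (hA : A.PosSemidef) : ∃ B : Matrix ι ι ℂ, A = Bᴴ * B := by
  classical
  open scoped MatrixOrder Matrix.Norms.L2Operator in
  exact CStarAlgebra.nonneg_iff_eq_star_mul_self.mp hA.nonneg

theorem _root_.Matrix.PosSemidef.trace_mul_nonneg {A B : Matrix ι ι ℂ}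
    (hA : A.PosSemidef) (hB : B.PosSemidef) : 0 ≤ (A * B).trace := by
  obtain ⟨C, rfl⟩ := hA.exists_eq_conjTranspose_mul_self
  rw [Matrix.mul_assoc, Matrix.trace_mul_comm]
  exact (hB.mul_mul_conjTranspose_same C).trace_nonneg

/-- Linear maps that agree on positive semidefinite matrices are equal. -/
theorem linearMap_ext_posSemidef {V : Type*} [AddCommMonoid V] [Module ℂ V]
    {f g : Matrix ι ι ℂ →ₗ[ℂ] V} (h : ∀ X : Matrix ι ι ℂ, X.PosSemidef → f X = g X) : f = g := by
  classical
  open scoped MatrixOrder Matrix.Norms.L2Operator in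
  refine LinearMap.ext_on (CStarAlgebra.span_nonneg (A := Matrix ι ι ℂ)) fun X hX => ?_
  exact h X (Matrix.nonneg_iff_posSemidef.mp hX)

/-- Covariance is assumed on states only; this extends it to all matrices. A positive semidefinite
matrix is zero or a multiple of a state. -/
theorem linearMap_ext_isState {V : Type*} [AddCommGroup V] [Module ℂ V]
    {f g : Matrix ι ι ℂ →ₗ[ℂ] V} (h : ∀ X : Matrix ι ι ℂ, IsState X → f X = g X) : f = g := by
  refine linearMap_ext_posSemidef fun X hX => ?_
  by_cases h0 : X.trace = 0
  · rw [hX.trace_eq_zero_iff.mp h0, map_zero, map_zero]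
  · have hs : IsState (X.trace⁻¹ • X) :=
      ⟨hX.smul (inv_nonneg_of_nonneg hX.trace_nonneg),
        by rw [Matrix.trace_smul, smul_eq_mul, inv_mul_cancel₀ h0]⟩
    have := congrArg (X.trace • ·) (h _ hs)
    simpa [smul_smul, h0] using this

/-- Self-duality of the positive cone. Since the traces are real, `D` and `Dᴴ` define the same
functional on the cone, which spans; testing on rank-one matrices then gives positivity. -/
theorem posSemidef_of_trace_mul_nonneg {D : Matrix ι ι ℂ}
    (h : ∀ X : Matrix ι ι ℂ, X.PosSemidef → 0 ≤ (X * D).trace) : D.PosSemidef := by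
  classical
  refine Matrix.PosSemidef.of_dotProduct_mulVec_nonneg ?_ fun x => ?_
  · have key : (Matrix.traceLinearMap ι ℂ ℂ).comp (LinearMap.mulRight ℂ Dᴴ) =
        (Matrix.traceLinearMap ι ℂ ℂ).comp (LinearMap.mulRight ℂ D) := by
      refine linearMap_ext_posSemidef fun X hX => ?_
      have h1 : (X * Dᴴ).trace = star (X * D).trace := by
        rw [← Matrix.trace_conjTranspose, Matrix.conjTranspose_mul, hX.1.eq,
          Matrix.trace_mul_comm]
      have h2 : star (X * D).trace = (X * D).trace := (IsSelfAdjoint.of_nonneg (h X hX)).star_eq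
      simpa using h1.trans h2
    ext i j
    have := LinearMap.congr_fun key (Matrix.single j i 1)
    simpa [Matrix.trace_single_mul] using this
  · have := h _ (Matrix.posSemidef_vecMulVec_self_star x)
    rwa [Matrix.vecMulVec_mul, Matrix.trace_vecMulVec, dotProduct_comm,
      ← Matrix.dotProduct_mulVec] at this

/-- Entries of a Gram matrix are inner products of vectors of norm at most one. This bounds the set
of POVMs. -/
theorem norm_entry_le_one_of_posSemidef {A : Matrix ι ι ℂ} (hA : A.PosSemidef)
    (h : ∀ i, (A i i).re ≤ 1) (i j : ι) : ‖A i j‖ ≤ 1 := by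
  obtain ⟨B, rfl⟩ := hA.exists_eq_conjTranspose_mul_self
  have hdiag : ∀ i, ∑ k, ‖B k i‖ ^ 2 ≤ 1 := fun i => by
    refine le_trans (le_of_eq ?_) (h i)
    rw [Matrix.mul_apply, Complex.re_sum]
    refine Finset.sum_congr rfl fun k _ => ?_
    rw [Matrix.conjTranspose_apply, Complex.star_def, ← Complex.normSq_eq_conj_mul_self,
      Complex.ofReal_re, Complex.normSq_eq_norm_sq]
  calc ‖(Bᴴ * B) i j‖ ≤ ∑ k, ‖B k i‖ * ‖B k j‖ := by
        rw [Matrix.mul_apply]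
        refine (norm_sum_le _ _).trans (le_of_eq (Finset.sum_congr rfl fun k _ => ?_))
        rw [norm_mul, Matrix.conjTranspose_apply, norm_star]
    _ ≤ ∑ k, (‖B k i‖ ^ 2 + ‖B k j‖ ^ 2) / 2 :=
        Finset.sum_le_sum fun k _ => by nlinarith [sq_nonneg (‖B k i‖ - ‖B k j‖)]
    _ ≤ 1 := by
        rw [← Finset.sum_div, Finset.sum_add_distrib]
        linarith [hdiag i, hdiag j]

theorem isClosed_posSemidef : IsClosed {A : Matrix ι ι ℂ | A.PosSemidef} := by
  simp only [Matrix.posSemidef_iff_dotProduct_mulVec, Set.ofPred_and, Set.ofPred_forall]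
  refine IsClosed.inter ?_ (isClosed_iInter fun x => ?_)
  · exact isClosed_eq (by fun_prop) continuous_id
  · exact isClosed_le continuous_const (by fun_prop)

end Positivity

/-! ### POVMs, attainment of the minimum, and the Heisenberg picture -/

section Measurements

variable {ι κ : Type} [Fintype ι] [Fintype κ] {m : ℕ}

theorem continuous_inconclusiveProb (ρ : Fin m → Matrix ι ι ℂ) (P : Fin m → ℝ) :
    Continuous (inconclusiveProb ρ P) := by
  unfold inconclusiveProb
  fun_prop

theorem continuous_errorProb (ρ : Fin m → Matrix ι ι ℂ) (n : Fin m) :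
    Continuous fun M => errorProb ρ M n := by
  unfold errorProb
  fun_prop

/-- With the denominator cleared, the rescaled constraint too is a weak inequality between
continuous functions. -/
theorem isClosed_setOf_meets (X : ConstraintKind) (ε : Fin m → ℝ) (ρ : Fin m → Matrix ι ι ℂ)
    (P : Fin m → ℝ) : IsClosed {M | Meets X ε ρ P M} := by
  have h1 := continuous_inconclusiveProb ρ P
  have h2 := continuous_errorProb ρ
  cases X <;> simp only [Meets, Set.ofPred_forall] <;>
    refine isClosed_iInter fun n => isClosed_le (h2 n) (by fun_prop)

variable [DecidableEq κ]

/-- The Heisenberg picture of a linear map. -/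
def heisenberg (Λ : Matrix κ κ ℂ →ₗ[ℂ] Matrix ι ι ℂ) (M : Matrix ι ι ℂ) : Matrix κ κ ℂ :=
  -- The indices are swapped because the trace of `single j i 1 * H` is `H i j`.
  Matrix.of fun i j => (Λ (Matrix.single j i 1) * M).trace

theorem trace_mul_heisenberg (Λ : Matrix κ κ ℂ →ₗ[ℂ] Matrix ι ι ℂ) (M : Matrix ι ι ℂ)
    (X : Matrix κ κ ℂ) : (X * heisenberg Λ M).trace = (Λ X * M).trace := by
  conv_rhs => rw [Matrix.matrix_eq_sum_single X]
  simp only [map_sum, Matrix.sum_mul, Matrix.trace_sum]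
  simp only [Matrix.trace, Matrix.diag_apply, Matrix.mul_apply (M := X)]
  refine Finset.sum_congr rfl fun i _ => Finset.sum_congr rfl fun j _ => ?_
  have : Matrix.single i j (X i j) = X i j • Matrix.single i j (1 : ℂ) := by
    simp
  rw [this, map_smul, Matrix.smul_mul]
  simp only [heisenberg, Matrix.of_apply, Matrix.trace, Matrix.diag_apply, Matrix.smul_apply,
    smul_eq_mul, Finset.mul_sum]

variable [DecidableEq ι]

theorem IsPOVM.re_diag_le_one {M : Fin (m + 1) → Matrix ι ι ℂ} (hM : IsPOVM M)
    (k : Fin (m + 1)) (i : ι) : (M k i i).re ≤ 1 := by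
  have h1 : ∑ k, (M k i i).re = 1 := by
    have := congrFun (congrFun hM.2 i) i
    rw [Matrix.sum_apply, Matrix.one_apply_eq] at this
    rw [← Complex.re_sum, this, Complex.one_re]
  rw [← h1]
  exact Finset.single_le_sum (f := fun k => (M k i i).re)
    (fun k _ => (Complex.nonneg_iff.mp (hM.1 k).diag_nonneg).1) (Finset.mem_univ k)

theorem isCompact_setOf_isPOVM :
    IsCompact {M : Fin (m + 1) → Matrix ι ι ℂ | IsPOVM M} := by
  have hc : IsCompact {A : Fin (m + 1) → ι → ι → ℂ | ∀ k i j, A k i j ∈ Metric.closedBall 0 1} := by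
    have := isCompact_univ_pi fun _ : Fin (m + 1) => isCompact_univ_pi fun _ : ι =>
      isCompact_univ_pi fun _ : ι => isCompact_closedBall (0 : ℂ) 1
    convert this using 1
    ext A
    simp
  refine hc.of_isClosed_subset ?_ fun M hM k i j => ?_
  · change IsClosed {M : Fin (m + 1) → Matrix ι ι ℂ | IsPOVM M}
    simp only [IsPOVM, Set.ofPred_and, Set.ofPred_forall]
    refine IsClosed.inter (isClosed_iInter fun k => ?_) ?_
    · exact isClosed_posSemidef.preimage (f := fun M : Fin (m + 1) → Matrix ι ι ℂ => M k)
        (continuous_apply k)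
    · exact isClosed_eq (by fun_prop) continuous_const
  · rw [mem_closedBall_zero_iff]
    exact norm_entry_le_one_of_posSemidef (hM.1 k) (hM.re_diag_le_one k) i j

theorem isCompact_stateValues (X : ConstraintKind) (ε : Fin m → ℝ) (ρ : Fin m → Matrix ι ι ℂ)
    (P : Fin m → ℝ) : IsCompact (stateValues X ε ρ P) := by
  have := (isCompact_setOf_isPOVM.inter_right (isClosed_setOf_meets X ε ρ P)).image
    (continuous_inconclusiveProb ρ P)
  convert this using 1
  ext p
  simp [stateValues, and_assoc]

/-- The measurement that is always inconclusive meets the constraints. -/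
theorem one_mem_stateValues (X : ConstraintKind) {ε : Fin m → ℝ} (hε : ∀ n, 0 ≤ ε n)
    {ρ : Fin m → Matrix ι ι ℂ} (hρ : ∀ n, (ρ n).trace = 1) {P : Fin m → ℝ} (hP : ∑ n, P n = 1) :
    1 ∈ stateValues X ε ρ P := by
  have hF : inconclusiveProb ρ P (Pi.single 0 1) = 1 := by
    simp [inconclusiveProb, hρ, hP]
  have hE : ∀ n, errorProb ρ (Pi.single 0 1) n = 0 := fun n => by
    simp [errorProb, hρ]
  refine ⟨Pi.single 0 1, ⟨fun k => ?_, by simp⟩, ?_, hF⟩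
  · by_cases hk : k = 0
    · subst hk; simpa using Matrix.PosSemidef.one
    · simpa [hk] using Matrix.PosSemidef.zero
  · cases X <;> intro n <;> simp [hE, hF, hε n]

theorem isLeast_stateOpt (X : ConstraintKind) {ε : Fin m → ℝ} (hε : ∀ n, 0 ≤ ε n)
    {ρ : Fin m → Matrix ι ι ℂ} (hρ : ∀ n, (ρ n).trace = 1) {P : Fin m → ℝ} (hP : ∑ n, P n = 1) :
    IsLeast (stateValues X ε ρ P) (stateOpt X ε ρ P) :=
  (isCompact_stateValues X ε ρ P).isLeast_sInf ⟨1, one_mem_stateValues X hε hρ hP⟩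

/-- Positivity passes to the dual map by self-duality of the cone, and trace preservation becomes
unitality. -/
theorem IsPOVM.heisenberg {Λ : Matrix κ κ ℂ →ₗ[ℂ] Matrix ι ι ℂ}
    (hpos : ∀ X : Matrix κ κ ℂ, X.PosSemidef → (Λ X).PosSemidef)
    (htr : ∀ X : Matrix κ κ ℂ, (Λ X).trace = X.trace)
    {M : Fin (m + 1) → Matrix ι ι ℂ} (hM : IsPOVM M) :
    IsPOVM fun k => ChannelUD.heisenberg Λ (M k) := by
  refine ⟨fun k => posSemidef_of_trace_mul_nonneg fun X hX => ?_, ?_⟩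
  · rw [trace_mul_heisenberg]
    exact (hpos X hX).trace_mul_nonneg (hM.1 k)
  · ext i j
    rw [Matrix.sum_apply]
    simp only [ChannelUD.heisenberg, Matrix.of_apply]
    rw [← Matrix.trace_sum, ← Matrix.mul_sum, hM.2, Matrix.mul_one, htr]
    by_cases hij : i = j
    · subst hij; simp
    · rw [Matrix.trace_single_eq_of_ne _ _ _ (Ne.symm hij), Matrix.one_apply_ne hij]

/-- Preprocessing the states by a positive trace-preserving map yields no new values. -/
theorem stateValues_subset_of_map {Λ : Matrix κ κ ℂ →ₗ[ℂ] Matrix ι ι ℂ}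
    (hpos : ∀ X : Matrix κ κ ℂ, X.PosSemidef → (Λ X).PosSemidef)
    (htr : ∀ X : Matrix κ κ ℂ, (Λ X).trace = X.trace)
    {σ : Fin m → Matrix ι ι ℂ} {τ : Fin m → Matrix κ κ ℂ} (h : ∀ n, Λ (τ n) = σ n)
    (X : ConstraintKind) (ε P : Fin m → ℝ) :
    stateValues X ε σ P ⊆ stateValues X ε τ P := by
  rintro p ⟨M, hM, hmeets, rfl⟩
  have hF : inconclusiveProb τ P (fun k => heisenberg Λ (M k)) = inconclusiveProb σ P M := by
    simp only [inconclusiveProb, trace_mul_heisenberg, h]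
  have hE : ∀ n, errorProb τ (fun k => heisenberg Λ (M k)) n = errorProb σ M n := fun n => by
    simp only [errorProb, trace_mul_heisenberg, h]
  refine ⟨_, hM.heisenberg hpos htr, ?_, hF⟩
  cases X <;> intro n <;> simpa only [hE, hF] using hmeets n

end Measurements

/-! ### Constructions of quantum channels -/

section Channels

variable {ι ι' ι'' κ : Type} [Fintype ι] [Fintype ι'] [Fintype ι''] [Fintype κ]

theorem extend_apply {ι ι' κ : Type} (Φ : Matrix ι ι ℂ →ₗ[ℂ] Matrix ι' ι' ℂ) (X : Matrix (ι × κ) (ι × κ) ℂ)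
    (p q : ι' × κ) :
    extend Φ κ X p q = Φ (Matrix.of fun i j => X (i, p.2) (j, q.2)) p.1 q.1 := rfl

theorem extend_kronecker {ι ι' κ : Type} (Φ : Matrix ι ι ℂ →ₗ[ℂ] Matrix ι' ι' ℂ) (A : Matrix ι ι ℂ)
    (B : Matrix κ κ ℂ) : extend Φ κ (A ⊗ₖ B) = Φ A ⊗ₖ B := by
  ext p q
  have : (Matrix.of fun i j => (A ⊗ₖ B) (i, p.2) (j, q.2)) = B p.2 q.2 • A := by
    ext i j
    simp [mul_comm]
  rw [extend_apply, this, map_smul]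
  simp [mul_comm]

theorem trace_extend {Φ : Matrix ι ι ℂ →ₗ[ℂ] Matrix ι' ι' ℂ}
    (hΦ : ∀ X : Matrix ι ι ℂ, (Φ X).trace = X.trace) (X : Matrix (ι × κ) (ι × κ) ℂ) :
    (extend Φ κ X).trace = X.trace := by
  simp only [Matrix.trace, Matrix.diag_apply, Fintype.sum_prod_type_right, extend_apply]
  exact Finset.sum_congr rfl fun a _ => hΦ _

/-- `IsChannel` tests only the ancillas `Fin r`; an enumeration of `κ` carries this to any finite
ancilla. -/
theorem IsChannel.posSemidef_extend {Φ : Matrix ι ι ℂ →ₗ[ℂ] Matrix ι' ι' ℂ} (hΦ : IsChannel Φ)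
    {X : Matrix (ι × κ) (ι × κ) ℂ} (hX : X.PosSemidef) : (extend Φ κ X).PosSemidef := by
  let e := Fintype.equivFin κ
  have h := (hΦ.1 _ _ (hX.submatrix (Prod.map id e.symm))).submatrix (Prod.map id e)
  convert h using 1
  ext p q
  simp [extend_apply]

theorem IsChannel.posSemidef {Φ : Matrix ι ι ℂ →ₗ[ℂ] Matrix ι' ι' ℂ} (hΦ : IsChannel Φ)
    {X : Matrix ι ι ℂ} (hX : X.PosSemidef) : (Φ X).PosSemidef :=
  (hΦ.posSemidef_extend (hX.submatrix (Prod.fst : ι × Unit → ι))).submatrix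
    fun i => (i, Unit.unit)

theorem IsChannel.extend {Φ : Matrix ι ι ℂ →ₗ[ℂ] Matrix ι' ι' ℂ} (hΦ : IsChannel Φ) :
    IsChannel (ChannelUD.extend Φ κ) :=
  ⟨fun r _ hX => (hΦ.posSemidef_extend (κ := κ × Fin r)
    (hX.submatrix (Equiv.prodAssoc ι κ (Fin r)).symm)).submatrix (Equiv.prodAssoc ι' κ (Fin r)),
    trace_extend hΦ.2⟩

theorem IsChannel.comp {Φ : Matrix ι' ι' ℂ →ₗ[ℂ] Matrix ι'' ι'' ℂ}
    {Ψ : Matrix ι ι ℂ →ₗ[ℂ] Matrix ι' ι' ℂ} (hΦ : IsChannel Φ) (hΨ : IsChannel Ψ) :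
    IsChannel (Φ ∘ₗ Ψ) :=
  ⟨fun r X hX => hΦ.1 r _ (hΨ.1 r X hX), fun X => (hΦ.2 _).trans (hΨ.2 X)⟩

theorem isChannel_reindex (e : ι ≃ ι') :
    IsChannel (Matrix.reindexLinearEquiv ℂ ℂ e e).toLinearMap :=
  ⟨fun r _ hX => hX.submatrix (Prod.map e.symm id), fun X => by
    simp [Matrix.trace, e.symm.sum_comp fun i => X i i]⟩

/-- The channel that discards its input and prepares the state `ρ`. -/
def prepare (ρ : Matrix ι' ι' ℂ) : Matrix ι ι ℂ →ₗ[ℂ] Matrix ι' ι' ℂ :=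
  (Matrix.traceLinearMap ι ℂ ℂ).smulRight ρ

theorem isChannel_prepare {ρ : Matrix ι' ι' ℂ} (hρ : IsState ρ) :
    IsChannel (prepare (ι := ι) ρ) := by
  refine ⟨fun r X hX => ?_, fun X => by simp [prepare, hρ.2]⟩
  -- This sum is the partial trace of `X` over the discarded system.
  have h : (∑ c, X.submatrix (fun a : Fin r => (c, a)) fun a => (c, a)).PosSemidef :=
    Matrix.posSemidef_sum _ fun c _ => hX.submatrix _
  have heq : extend (prepare ρ) (Fin r) X =
      ρ ⊗ₖ ∑ c, X.submatrix (fun a : Fin r => (c, a)) fun a => (c, a) := by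
    ext p q
    simp [prepare, extend_apply, Matrix.trace, Matrix.sum_apply, mul_comm]
  rw [heq]
  exact hρ.1.kronecker h

/-- The completely positive map with Kraus operators `K`. -/
def krausMap {S : Type} [Fintype S] (K : S → Matrix ι' ι ℂ) :
    Matrix ι ι ℂ →ₗ[ℂ] Matrix ι' ι' ℂ where
  toFun X := ∑ s, K s * X * (K s)ᴴ
  map_add' X Y := by simp [Matrix.mul_add, Matrix.add_mul, Finset.sum_add_distrib]
  map_smul' c X := by simp [Finset.smul_sum]

theorem isChannel_krausMap [DecidableEq ι] {S : Type} [Fintype S] {K : S → Matrix ι' ι ℂ}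
    (hK : ∑ s, (K s)ᴴ * K s = 1) : IsChannel (krausMap K) := by
  refine ⟨fun r X hX => ?_, fun X => ?_⟩
  · let L : S → Matrix (ι' × Fin r) (ι × Fin r) ℂ := fun s => K s ⊗ₖ 1
    have h : extend (krausMap K) (Fin r) X = ∑ s, L s * X * (L s)ᴴ := by
      ext p q
      rw [Matrix.sum_apply, extend_apply]
      simp only [krausMap, LinearMap.coe_mk, AddHom.coe_mk, Matrix.sum_apply]
      refine Finset.sum_congr rfl fun s _ => ?_
      simp [L, Matrix.mul_apply, Fintype.sum_prod_type, Matrix.one_apply, Finset.sum_mul,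
        apply_ite (starRingEnd ℂ)]
    rw [h]
    exact Matrix.posSemidef_sum _ fun s _ => hX.mul_mul_conjTranspose_same _
  · change (∑ s, K s * X * (K s)ᴴ).trace = X.trace
    rw [Matrix.trace_sum]
    simp_rw [Matrix.mul_assoc, Matrix.trace_mul_comm (K _), Matrix.mul_assoc]
    rw [← Matrix.trace_sum, ← Matrix.mul_sum, hK, Matrix.mul_one]

end Channels

/-! ### Bell measurement and teleportation through Choi states -/

section Teleportation

/-- Orthogonality of the characters of the cyclic group: a geometric sum with ratio `ω ^ (p - q)`, a
`d`-th root of unity. -/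
theorem sum_exp_mul_conj_exp {d : ℕ} (p q : Fin d) :
    ∑ b : Fin d, Complex.exp (2 * Real.pi * Complex.I * ((b : ℕ) : ℂ) * ((p : ℕ) : ℂ) / (d : ℂ)) *
      star (Complex.exp (2 * Real.pi * Complex.I * ((b : ℕ) : ℂ) * ((q : ℕ) : ℂ) / (d : ℂ))) =
      if p = q then (d : ℂ) else 0 := by
  have hd : d ≠ 0 := by have := p.2; omega
  let ω : ℂ := Complex.exp (2 * Real.pi * Complex.I / d)
  have hω : IsPrimitiveRoot ω d := Complex.isPrimitiveRoot_exp d hd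
  have hω0 : ω ≠ 0 := Complex.exp_ne_zero _
  have hconj : star ω = ω⁻¹ := by
    rw [← Complex.exp_neg, Complex.star_def, ← Complex.exp_conj]
    congr 1
    simp [neg_div, Complex.conj_ofNat]
  have hpow : ∀ b j : ℕ,
      Complex.exp (2 * Real.pi * Complex.I * (b : ℂ) * (j : ℂ) / (d : ℂ)) = ω ^ (b * j) := by
    intro b j
    rw [← Complex.exp_nat_mul]
    congr 1
    push_cast
    ring
  let z : ℂ := ω ^ (p : ℕ) * (ω ^ (q : ℕ))⁻¹
  have hterm : ∀ b : Fin d,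
      Complex.exp (2 * Real.pi * Complex.I * ((b : ℕ) : ℂ) * ((p : ℕ) : ℂ) / (d : ℂ)) *
        star (Complex.exp (2 * Real.pi * Complex.I * ((b : ℕ) : ℂ) * ((q : ℕ) : ℂ) / (d : ℂ))) =
      z ^ (b : ℕ) := by
    intro b
    rw [hpow, hpow, star_pow, hconj, mul_pow, inv_pow, inv_pow, ← pow_mul, ← pow_mul,
      mul_comm (b : ℕ), mul_comm (b : ℕ)]
  rw [Finset.sum_congr rfl fun b _ => hterm b, Fin.sum_univ_eq_sum_range (fun b => z ^ b) d]
  split_ifs with h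
  · have hz : z = 1 := by
      simp only [z, h]
      exact mul_inv_cancel₀ (pow_ne_zero _ hω0)
    simp [hz]
  · have hz : z ≠ 1 := fun hz => h <| Fin.ext <| hω.pow_inj p.2 q.2 <| by
      exact (mul_inv_eq_one₀ (pow_ne_zero _ hω0)).mp hz
    have hzd : z ^ d = 1 := by
      rw [mul_pow, inv_pow, ← pow_mul, ← pow_mul, mul_comm (p : ℕ), mul_comm (q : ℕ), pow_mul,
        pow_mul, hω.pow_eq_one]
      simp
    have := mul_geom_sum z d
    rw [hzd, sub_self] at this
    exact (mul_eq_zero.mp this).resolve_left (sub_ne_zero.mpr hz)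

/-- Completeness of the Bell basis. -/
theorem sum_pauli_mul_star {d : ℕ} (i j p q : Fin d) :
    ∑ a, ∑ b, pauli d a b i p * star (pauli d a b j q) = if i = j ∧ p = q then (d : ℂ) else 0 := by
  have : NeZero d := ⟨by have := p.2; omega⟩
  -- The clock sum over `b` forces `p = q`; in the shift sum only `a = i - p` can then survive.
  have h : ∀ a, ∑ b, pauli d a b i p * star (pauli d a b j q) =
      if i = p + a ∧ j = q + a ∧ p = q then (d : ℂ) else 0 := by
    intro a
    simp only [pauli, Matrix.of_apply]
    by_cases h1 : i = p + a
    · by_cases h2 : j = q + a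
      · simp only [h1, h2, true_and, if_true]
        exact sum_exp_mul_conj_exp p q
      · simp [h2]
    · simp [h1]
  rw [Finset.sum_congr rfl fun a _ => h a]
  by_cases hpq : p = q
  · subst hpq
    by_cases hij : i = j
    · subst hij
      have h2 : ∀ a, (i = p + a) ↔ (i - p = a) := fun a => by
        constructor
        · rintro rfl; simp
        · rintro rfl; simp
      simp [h2]
    · have : ∀ a, ¬ (i = p + a ∧ j = p + a) := fun a h => hij (h.1.trans h.2.symm)
      simp [hij, this]
  · simp [hpq]

variable {d d' m : ℕ}

theorem inv_sqrt_mul_self (d : ℕ) :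
    ((Real.sqrt d : ℝ) : ℂ)⁻¹ * ((Real.sqrt d : ℝ) : ℂ)⁻¹ = (d : ℂ)⁻¹ := by
  rw [← mul_inv, ← Complex.ofReal_mul, Real.mul_self_sqrt (Nat.cast_nonneg d),
    Complex.ofReal_natCast]

theorem maxEnt_apply (p q : Fin d × Fin d) :
    maxEnt d p q = if p.1 = p.2 ∧ q.1 = q.2 then (d : ℂ)⁻¹ else 0 := by
  simp only [maxEnt, maxEntKet, Matrix.vecMulVec_apply, Pi.star_apply]
  by_cases h1 : p.1 = p.2 <;> by_cases h2 : q.1 = q.2 <;> simp [h1, h2, ← inv_sqrt_mul_self d]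

theorem choiState_apply (Φ : Matrix (Fin d) (Fin d) ℂ →ₗ[ℂ] Matrix (Fin d') (Fin d') ℂ)
    (p q : Fin d' × Fin d) :
    choiState Φ p q = (d : ℂ)⁻¹ * Φ (Matrix.single p.2 q.2 1) p.1 q.1 := by
  have h : (Matrix.of fun i j => maxEnt d (i, p.2) (j, q.2)) =
      (d : ℂ)⁻¹ • Matrix.single p.2 q.2 (1 : ℂ) := by
    ext i j
    simp [maxEnt_apply, Matrix.single_apply, eq_comm]
  rw [choiState, extend_apply, h, map_smul]
  rfl

theorem JointlyTeleportationCovariant.exists_unitary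
    {E : Fin m → (Matrix (Fin d) (Fin d) ℂ →ₗ[ℂ] Matrix (Fin d') (Fin d') ℂ)}
    (hcov : JointlyTeleportationCovariant E) (a b : Fin d) :
    ∃ V ∈ Matrix.unitaryGroup (Fin d') ℂ, ∀ n X,
      E n (pauli d a b * X * (pauli d a b)ᴴ) = V * E n X * Vᴴ := by
  obtain ⟨V, hV, h⟩ := hcov a b
  refine ⟨V, hV, fun n X => ?_⟩
  have : (E n) ∘ₗ (LinearMap.mulRight ℂ (pauli d a b)ᴴ ∘ₗ LinearMap.mulLeft ℂ (pauli d a b)) =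
      (LinearMap.mulRight ℂ Vᴴ ∘ₗ LinearMap.mulLeft ℂ V) ∘ₗ E n :=
    linearMap_ext_isState fun X hX => h n X hX
  exact LinearMap.congr_fun this X

variable {κ : Type} [Fintype κ] [DecidableEq κ]

/-- Kraus operator of teleportation through a Choi state: project the probe and the input part of
the Choi state on the Bell vector of `U` and apply the correction `V†` to the output part. -/
def teleportKraus (κ : Type) [DecidableEq κ] (U : Matrix (Fin d) (Fin d) ℂ)
    (V : Matrix (Fin d') (Fin d') ℂ) :
    Matrix (Fin d' × κ) ((Fin d × κ) × (Fin d' × Fin d)) ℂ :=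
  Matrix.of fun o s =>
    if o.2 = s.1.2 then
      ((Real.sqrt d : ℝ) : ℂ)⁻¹ * (star (V s.2.1 o.1) * U s.2.2 s.1.1) else 0

/-- The correction cancels by unitarity, leaving the projector on a Bell vector; summing over the
Paulis is then completeness of the Bell basis. -/
theorem teleportKraus_conjTranspose_mul_self {U : Matrix (Fin d) (Fin d) ℂ}
    {V : Matrix (Fin d') (Fin d') ℂ} (hV : V ∈ Matrix.unitaryGroup (Fin d') ℂ)
    (s t : (Fin d × κ) × (Fin d' × Fin d)) :
    ((teleportKraus κ U V)ᴴ * teleportKraus κ U V) s t =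
      if s.1.2 = t.1.2 ∧ s.2.1 = t.2.1 then
        (d : ℂ)⁻¹ * (U t.2.2 t.1.1 * star (U s.2.2 s.1.1)) else 0 := by
  have hVV : ∑ o, V s.2.1 o * star (V t.2.1 o) = if s.2.1 = t.2.1 then 1 else 0 := by
    have := congrFun (congrFun (Matrix.mem_unitaryGroup_iff.mp hV) s.2.1) t.2.1
    rwa [Matrix.mul_apply, Matrix.one_apply] at this
  rw [Matrix.mul_apply, Fintype.sum_prod_type]
  simp only [teleportKraus, Matrix.conjTranspose_apply, Matrix.of_apply]
  by_cases h : s.1.2 = t.1.2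
  · have : ∀ o : Fin d', ∑ x : κ,
        star (if x = s.1.2 then
          ((Real.sqrt d : ℝ) : ℂ)⁻¹ * (star (V s.2.1 o) * U s.2.2 s.1.1) else 0) *
        (if x = t.1.2 then
          ((Real.sqrt d : ℝ) : ℂ)⁻¹ * (star (V t.2.1 o) * U t.2.2 t.1.1) else 0) =
        (((Real.sqrt d : ℝ) : ℂ)⁻¹ * ((Real.sqrt d : ℝ) : ℂ)⁻¹) *
          (U t.2.2 t.1.1 * star (U s.2.2 s.1.1)) * (V s.2.1 o * star (V t.2.1 o)) := by
      intro o
      rw [h, Finset.sum_eq_single t.1.2 (fun x _ hx => by simp [hx]) (by simp)]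
      simp
      ring
    simp only [this]
    rw [← Finset.mul_sum, hVV, inv_sqrt_mul_self]
    simp [h]
  · rw [if_neg (fun h' => h h'.1)]
    refine Finset.sum_eq_zero fun o _ => Finset.sum_eq_zero fun x _ => ?_
    by_cases hx : x = s.1.2
    · simp [hx, h]
    · simp [hx]

theorem sum_teleportKraus {V : Fin d → Fin d → Matrix (Fin d') (Fin d') ℂ}
    (hV : ∀ a b, V a b ∈ Matrix.unitaryGroup (Fin d') ℂ) :
    ∑ s : Fin d × Fin d, (teleportKraus κ (pauli d s.1 s.2) (V s.1 s.2))ᴴ *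
      teleportKraus κ (pauli d s.1 s.2) (V s.1 s.2) = 1 := by
  ext s t
  have hd : (d : ℂ) ≠ 0 := by
    have := s.1.1.2
    exact Nat.cast_ne_zero.mpr (by omega)
  simp only [Matrix.sum_apply, teleportKraus_conjTranspose_mul_self (hV _ _)]
  rw [Fintype.sum_prod_type]
  by_cases h : s.1.2 = t.1.2 ∧ s.2.1 = t.2.1
  · simp only [if_pos h, ← Finset.mul_sum, sum_pauli_mul_star]
    obtain ⟨⟨s1, s2⟩, s3, s4⟩ := s
    obtain ⟨⟨t1, t2⟩, t3, t4⟩ := t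
    obtain ⟨rfl, rfl⟩ := h
    by_cases h2 : t4 = s4 ∧ t1 = s1
    · obtain ⟨rfl, rfl⟩ := h2
      simp [hd]
    · rw [if_neg h2, Matrix.one_apply_ne, mul_zero]
      simp only [ne_eq, Prod.mk.injEq]
      tauto
  · simp only [if_neg h]
    rw [Matrix.one_apply_ne (fun hst => h (by rw [hst]; exact ⟨rfl, rfl⟩))]
    simp

theorem linearMap_apply_eq_sum {ι ι' : Type} [Fintype ι] [DecidableEq ι]
    (Φ : Matrix ι ι ℂ →ₗ[ℂ] Matrix ι' ι' ℂ) (W : Matrix ι ι ℂ) (i j : ι') :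
    Φ W i j = ∑ r, ∑ s, W r s * Φ (Matrix.single r s 1) i j := by
  conv_lhs => rw [Matrix.matrix_eq_sum_single W]
  simp only [map_sum, Matrix.sum_apply]
  refine Finset.sum_congr rfl fun r _ => Finset.sum_congr rfl fun s _ => ?_
  have : Matrix.single r s (W r s) = W r s • Matrix.single r s (1 : ℂ) := by simp
  rw [this, map_smul, Matrix.smul_apply, smul_eq_mul]

theorem sum_triple_comm {α β γ δ η : Type} [Fintype α] [Fintype β] [Fintype γ] [Fintype δ]
    [Fintype η] (f : α → β → γ → δ → η → ℂ) :
    ∑ q, ∑ s, ∑ p, ∑ a, ∑ r, f q s p a r = ∑ a, ∑ r, ∑ q, ∑ s, ∑ p, f q s p a r := by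
  have h := Finset.sum_comm (s := Finset.univ) (t := Finset.univ)
    (f := fun (x : α × β × γ) (y : δ × η) => f x.1 x.2.1 x.2.2 y.1 y.2)
  simpa only [Fintype.sum_prod_type] using h

theorem sum_teleportKraus_mul {U : Matrix (Fin d) (Fin d) ℂ} {V : Matrix (Fin d') (Fin d') ℂ}
    (o : Fin d' × κ) (f : (Fin d × κ) × (Fin d' × Fin d) → ℂ) :
    ∑ s, teleportKraus κ U V o s * f s = ∑ p, ∑ a, ∑ r,
      ((Real.sqrt d : ℝ) : ℂ)⁻¹ * (star (V a o.1) * U r p) * f ((p, o.2), (a, r)) := by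
  simp only [Fintype.sum_prod_type, teleportKraus, Matrix.of_apply, ite_mul, zero_mul]
  refine Finset.sum_congr rfl fun p _ => ?_
  rw [Finset.sum_eq_single o.2 (fun x _ hx => by simp [Ne.symm hx]) (by simp)]
  simp

/-- One factor `d⁻¹` comes from the two normalisations of the Bell vector, the other from the Choi
state. -/
theorem teleportKraus_mul_mul_conjTranspose
    (Φ : Matrix (Fin d) (Fin d) ℂ →ₗ[ℂ] Matrix (Fin d') (Fin d') ℂ)
    (U : Matrix (Fin d) (Fin d) ℂ) (V : Matrix (Fin d') (Fin d') ℂ)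
    (X : Matrix (Fin d × κ) (Fin d × κ) ℂ) (o o' : Fin d' × κ) :
    (teleportKraus κ U V * (X ⊗ₖ choiState Φ) * (teleportKraus κ U V)ᴴ) o o' =
      (d : ℂ)⁻¹ * (d : ℂ)⁻¹ *
        (Vᴴ * Φ (U * (Matrix.of fun i j => X (i, o.2) (j, o'.2)) * Uᴴ) * V) o.1 o'.1 := by
  have hstar : ∀ (A : Matrix (Fin d' × κ) ((Fin d × κ) × (Fin d' × Fin d)) ℂ),
      (A * (teleportKraus κ U V)ᴴ) o o' = star (∑ t, teleportKraus κ U V o' t * star (A o t)) := by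
    intro A
    simp [Matrix.mul_apply, mul_comm]
  rw [hstar, sum_teleportKraus_mul]
  simp only [Matrix.mul_apply (M := teleportKraus κ U V), sum_teleportKraus_mul,
    Matrix.kroneckerMap_apply, choiState_apply]
  simp only [Matrix.mul_apply, linearMap_apply_eq_sum Φ (U * _ * Uᴴ)]
  rw [← inv_sqrt_mul_self]
  simp only [star_sum, star_mul', star_star, Finset.mul_sum, Finset.sum_mul,
    Matrix.conjTranspose_apply, Matrix.of_apply]
  have hsq : star (((Real.sqrt d : ℝ) : ℂ)⁻¹) = ((Real.sqrt d : ℝ) : ℂ)⁻¹ := by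
    rw [star_inv₀, Complex.star_def, Complex.conj_ofReal]
  rw [Finset.sum_comm]
  refine Finset.sum_congr rfl fun b _ => ?_
  rw [sum_triple_comm]
  refine Finset.sum_congr rfl fun a _ => Finset.sum_congr rfl fun r _ => ?_
  rw [Finset.sum_comm]
  refine Finset.sum_congr rfl fun s _ => Finset.sum_congr rfl fun q _ =>
    Finset.sum_congr rfl fun p _ => ?_
  rw [hsq]
  ring

/-- Teleportation simulation: one channel, the same for the whole family, produces the action of
each covariant channel from its Choi state. -/
theorem JointlyTeleportationCovariant.exists_teleportation
    {E : Fin m → (Matrix (Fin d) (Fin d) ℂ →ₗ[ℂ] Matrix (Fin d') (Fin d') ℂ)}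
    (hcov : JointlyTeleportationCovariant E) (hd : d ≠ 0) (κ : Type) [Fintype κ] [DecidableEq κ] :
    ∃ T : Matrix ((Fin d × κ) × (Fin d' × Fin d)) ((Fin d × κ) × (Fin d' × Fin d)) ℂ →ₗ[ℂ]
        Matrix (Fin d' × κ) (Fin d' × κ) ℂ,
      IsChannel T ∧ ∀ n X, T (X ⊗ₖ choiState (E n)) = extend (E n) κ X := by
  choose V hV h using hcov.exists_unitary
  refine ⟨krausMap fun s : Fin d × Fin d => teleportKraus κ (pauli d s.1 s.2) (V s.1 s.2),
    isChannel_krausMap (sum_teleportKraus hV), fun n X => ?_⟩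
  ext o o'
  have hd' : (d : ℂ) ≠ 0 := Nat.cast_ne_zero.mpr hd
  have key : ∀ (a b : Fin d) (Y : Matrix (Fin d') (Fin d') ℂ),
      (V a b)ᴴ * (V a b * Y * (V a b)ᴴ) * V a b = Y := by
    intro a b Y
    have h1 : (V a b)ᴴ * V a b = 1 := Matrix.mem_unitaryGroup_iff'.mp (hV a b)
    calc (V a b)ᴴ * (V a b * Y * (V a b)ᴴ) * V a b
        = ((V a b)ᴴ * V a b) * Y * ((V a b)ᴴ * V a b) := by simp only [Matrix.mul_assoc]
      _ = Y := by rw [h1, Matrix.one_mul, Matrix.mul_one]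
  simp only [krausMap, LinearMap.coe_mk, AddHom.coe_mk, Matrix.sum_apply,
    teleportKraus_mul_mul_conjTranspose, h, key, extend_apply]
  -- After correction all `d ^ 2` outcomes contribute the same matrix, each with weight `d⁻¹ * d⁻¹`.
  simp [Fintype.card_prod]
  field_simp

end Teleportation

/-! ### Stretching adaptive protocols -/

section Simulation

variable {d d' m : ℕ}

theorem tensorPow_succ {ι : Type} (ρ : Matrix ι ι ℂ) (k : ℕ) (f g : Fin k → ι) (x y : ι) :
    tensorPow ρ (k + 1) (Fin.snoc f x) (Fin.snoc g y) = tensorPow ρ k f g * ρ x y := by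
  simp [tensorPow, Fin.prod_univ_castSucc]

theorem trace_tensorPow {ι : Type} [Fintype ι] [DecidableEq ι] (ρ : Matrix ι ι ℂ) (k : ℕ) :
    (tensorPow ρ k).trace = ρ.trace ^ k := by
  simp only [Matrix.trace, Matrix.diag_apply, tensorPow, Matrix.of_apply]
  exact (Fintype.sum_pow (fun i => ρ i i) k).symm

theorem maxEnt_isState (hd : d ≠ 0) : IsState (maxEnt d) := by
  refine ⟨Matrix.posSemidef_vecMulVec_self_star _, ?_⟩
  simp [Matrix.trace, maxEnt_apply, Fintype.sum_prod_type, hd]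

theorem trace_choiState {Φ : Matrix (Fin d) (Fin d) ℂ →ₗ[ℂ] Matrix (Fin d') (Fin d') ℂ}
    (hΦ : IsChannel Φ) (hd : d ≠ 0) : (choiState Φ).trace = 1 :=
  (trace_extend hΦ.2 _).trans (maxEnt_isState hd).2

/-- Split off the last factor of a tensor power. -/
def snocSplit (D : Type) (k : ℕ) : (Fin (k + 1) → D) ≃ (Fin k → D) × D :=
  (Fin.snocEquiv fun _ => D).symm.trans (Equiv.prodComm _ _)

theorem reindex_snocSplit_tensorPow {D : Type} (ρ : Matrix D D ℂ) (k : ℕ) :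
    Matrix.reindex (snocSplit D k) (snocSplit D k) (tensorPow ρ (k + 1)) =
      tensorPow ρ k ⊗ₖ ρ := by
  ext p q
  exact tensorPow_succ ρ k p.1 q.1 p.2 q.2

/-- If the input of a covariant channel can be produced from `k` Choi states, then its output
can be produced from `k + 1` of them. -/
theorem JointlyTeleportationCovariant.exists_simulation_extend
    {E : Fin m → (Matrix (Fin d) (Fin d) ℂ →ₗ[ℂ] Matrix (Fin d') (Fin d') ℂ)}
    (hcov : JointlyTeleportationCovariant E) (hd : d ≠ 0) {κ : Type} [Fintype κ] [DecidableEq κ]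
    {k : ℕ} {σ : Fin m → Matrix (Fin d × κ) (Fin d × κ) ℂ}
    (h : ∃ Λ : Matrix (Fin k → Fin d' × Fin d) (Fin k → Fin d' × Fin d) ℂ →ₗ[ℂ]
      Matrix (Fin d × κ) (Fin d × κ) ℂ,
      IsChannel Λ ∧ ∀ n, Λ (tensorPow (choiState (E n)) k) = σ n) :
    ∃ Λ : Matrix (Fin (k + 1) → Fin d' × Fin d) (Fin (k + 1) → Fin d' × Fin d) ℂ →ₗ[ℂ]
      Matrix (Fin d' × κ) (Fin d' × κ) ℂ,
      IsChannel Λ ∧ ∀ n, Λ (tensorPow (choiState (E n)) (k + 1)) = extend (E n) κ (σ n) := by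
  obtain ⟨Λ, hΛ, hσ⟩ := h
  obtain ⟨T, hT, hTE⟩ := hcov.exists_teleportation hd κ
  refine ⟨(T ∘ₗ extend Λ (Fin d' × Fin d)) ∘ₗ (Matrix.reindexLinearEquiv ℂ ℂ
    (snocSplit (Fin d' × Fin d) k) (snocSplit (Fin d' × Fin d) k)).toLinearMap,
    (hT.comp hΛ.extend).comp (isChannel_reindex _), fun n => ?_⟩
  change T (extend Λ _ (Matrix.reindex _ _ _)) = _
  rw [reindex_snocSplit_tensorPow, extend_kronecker, hσ, hTE]

/-- `Λ` is chosen before `n`: the protocol's own operations do not depend on the unknown channel,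
and teleportation simulates each use by a common channel. -/
theorem JointlyTeleportationCovariant.exists_simulation_probe
    {E : Fin m → (Matrix (Fin d) (Fin d) ℂ →ₗ[ℂ] Matrix (Fin d') (Fin d') ℂ)}
    (hcov : JointlyTeleportationCovariant E) (hd : d ≠ 0) (A : AdaptiveProtocol d d') (k : ℕ) :
    ∃ Λ : Matrix (Fin k → Fin d' × Fin d) (Fin k → Fin d' × Fin d) ℂ →ₗ[ℂ]
      Matrix (Fin d × A.anc k) (Fin d × A.anc k) ℂ,
      IsChannel Λ ∧ ∀ n, Λ (tensorPow (choiState (E n)) k) = A.probe (E n) k := by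
  induction k with
  | zero =>
    -- Before the first use no Choi state is consumed: the zeroth tensor power is the `1 × 1`
    -- identity.
    refine ⟨prepare A.init, isChannel_prepare A.init_isState, fun n => ?_⟩
    simp [prepare, trace_tensorPow, AdaptiveProtocol.probe]
  | succ k ih =>
    obtain ⟨Λ, hΛ, h⟩ := hcov.exists_simulation_extend hd ih
    exact ⟨A.op k ∘ₗ Λ, (A.op_isChannel k).comp hΛ, fun n => congrArg (A.op k) (h n)⟩

theorem stateValues_output_subset
    {E : Fin m → (Matrix (Fin d) (Fin d) ℂ →ₗ[ℂ] Matrix (Fin d') (Fin d') ℂ)}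
    (hcov : JointlyTeleportationCovariant E) (hd : d ≠ 0) (A : AdaptiveProtocol d d') {u : ℕ}
    (hu : u ≠ 0) (X : ConstraintKind) (ε P : Fin m → ℝ) :
    stateValues X ε (fun n => A.output (E n) u) P ⊆
      stateValues X ε (fun n => tensorPow (choiState (E n)) u) P := by
  -- The output after `k + 1` uses is one channel use applied to the probe number `k`.
  obtain ⟨k, rfl⟩ := Nat.exists_eq_succ_of_ne_zero hu
  obtain ⟨Λ, hΛ, h⟩ :=
    hcov.exists_simulation_extend hd (hcov.exists_simulation_probe hd A k)
  exact stateValues_subset_of_map (fun X hX => hΛ.posSemidef hX) hΛ.2 h X ε P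

end Simulation

/-! ### The non-adaptive strategy as an adaptive protocol -/

section Parallel

variable {d d' : ℕ}

/-- Expand each factor `Φ ρ` in matrix units and distribute the product over the sums. -/
theorem mapTensorPow_tensorPow {ι ι' : Type} [Fintype ι] [DecidableEq ι]
    (Φ : Matrix ι ι ℂ →ₗ[ℂ] Matrix ι' ι' ℂ) (ρ : Matrix ι ι ℂ) (u : ℕ) :
    mapTensorPow Φ u (tensorPow ρ u) = tensorPow (Φ ρ) u := by
  ext i j
  have h : ∀ t : Fin u, Φ ρ (i t) (j t) =
      ∑ x : ι × ι, ρ x.1 x.2 * Φ (Matrix.single x.1 x.2 1) (i t) (j t) := by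
    intro t
    rw [linearMap_apply_eq_sum, Fintype.sum_prod_type]
  simp only [tensorPow, mapTensorPow, Matrix.of_apply, h, Matrix.sum_apply, Matrix.smul_apply,
    smul_eq_mul, ← Finset.prod_mul_distrib]
  rw [Finset.prod_univ_sum, Fintype.piFinset_univ, ← Fintype.sum_prod_type'
    (f := fun (k l : Fin u → ι) =>
      ∏ t, ρ (k t) (l t) * Φ (Matrix.single (k t) (l t) 1) (i t) (j t))]
  exact ((Equiv.arrowProdEquivProdArrow (Fin u) (fun _ => ι) (fun _ => ι)).sum_comp
    (fun x : (Fin u → ι) × (Fin u → ι) =>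
      ∏ t, ρ (x.1 t) (x.2 t) * Φ (Matrix.single (x.1 t) (x.2 t) 1) (i t) (j t))).symm

theorem parallelOutput_eq_tensorPow
    (Φ : Matrix (Fin d) (Fin d) ℂ →ₗ[ℂ] Matrix (Fin d') (Fin d') ℂ) (u : ℕ) :
    parallelOutput Φ u = tensorPow (choiState Φ) u :=
  mapTensorPow_tensorPow _ _ _

/-- The ancilla of the parallel protocol before use number `k`: the outputs of the earlier uses,
and the second half of the current maximally entangled state. -/
abbrev ParallelAnc (d d' k : ℕ) : Type := (Fin k → Fin d' × Fin d) × Fin d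

/-- Move the pair that has just passed the channel to storage, in the last position. -/
def store (d d' k : ℕ) :
    Fin d' × ParallelAnc d d' k ≃ (Fin (k + 1) → Fin d' × Fin d) where
  toFun x := Fin.snoc x.2.1 (x.1, x.2.2)
  invFun f := ((f (Fin.last k)).1, (Fin.init f, (f (Fin.last k)).2))
  left_inv x := by simp
  right_inv f := by simp

/-- The isometry that stores the used pair and prepares a fresh maximally entangled pair. -/
def refreshKraus (d d' k : ℕ) :
    Matrix (Fin d × ParallelAnc d d' (k + 1)) (Fin d' × ParallelAnc d d' k) ℂ :=
  Matrix.of fun p x =>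
    if p.2.1 = store d d' k x then maxEntKet d (p.1, p.2.2) else 0

theorem refreshKraus_conj_apply (k : ℕ)
    (Y : Matrix (Fin d' × ParallelAnc d d' k) (Fin d' × ParallelAnc d d' k) ℂ)
    (p q : Fin d × ParallelAnc d d' (k + 1)) :
    (refreshKraus d d' k * Y * (refreshKraus d d' k)ᴴ) p q =
      Y ((store d d' k).symm p.2.1) ((store d d' k).symm q.2.1) *
        maxEnt d (p.1, p.2.2) (q.1, q.2.2) := by
  have h : ∀ (p : Fin d × ParallelAnc d d' (k + 1)) x,
      p.2.1 = store d d' k x ↔ (store d d' k).symm p.2.1 = x := fun p x =>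
    ((store d d' k).symm_apply_eq).symm
  simp only [Matrix.mul_apply, refreshKraus, Matrix.of_apply, Matrix.conjTranspose_apply, h]
  simp [maxEnt, Matrix.vecMulVec_apply, apply_ite (starRingEnd ℂ)]
  ring

/-- Relabelling by `store` is injective and `maxEntKet` is a unit vector. -/
theorem refreshKraus_conjTranspose_mul_self (hd : d ≠ 0) (k : ℕ) :
    (refreshKraus d d' k)ᴴ * refreshKraus d d' k = 1 := by
  have hz : ∑ a : Fin d, ∑ b : Fin d, star (maxEntKet d (a, b)) * maxEntKet d (a, b) = 1 := by
    have := (maxEnt_isState hd).2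
    simpa [Matrix.trace, maxEnt, Matrix.vecMulVec_apply, Fintype.sum_prod_type, mul_comm] using this
  ext x y
  simp only [Matrix.mul_apply, refreshKraus, Matrix.of_apply, Matrix.conjTranspose_apply,
    Fintype.sum_prod_type]
  rw [Matrix.one_apply]
  split_ifs with hxy
  · subst hxy
    rw [← hz]
    refine Finset.sum_congr rfl fun a _ => ?_
    rw [Finset.sum_comm]
    refine Finset.sum_congr rfl fun b _ => ?_
    rw [Finset.sum_eq_single (store d d' k x) (fun f _ hf => by simp [hf]) (by simp)]
    simp
  · refine Finset.sum_eq_zero fun a _ => Finset.sum_eq_zero fun f _ =>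
      Finset.sum_eq_zero fun b _ => ?_
    by_cases hf : f = store d d' k x
    · have : store d d' k x ≠ store d d' k y := fun h => hxy ((store d d' k).injective h)
      simp [hf, this]
    · simp [hf]

/-- The protocol that sends one half of a fresh maximally entangled state in every round. -/
def parallelProtocol (d d' : ℕ) (hd : d ≠ 0) : AdaptiveProtocol d d' where
  anc := ParallelAnc d d'
  -- The storage is initially indexed by `Fin 0 → _`, which has exactly one element.
  init := Matrix.reindex (Equiv.prodCongr (Equiv.refl _) (Equiv.uniqueProd _ _).symm)
    (Equiv.prodCongr (Equiv.refl _) (Equiv.uniqueProd _ _).symm) (maxEnt d)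
  init_isState := ⟨(maxEnt_isState hd).1.submatrix _,
    ((isChannel_reindex _).2 _).trans (maxEnt_isState hd).2⟩
  op k := krausMap fun _ : Unit => refreshKraus d d' k
  op_isChannel k := isChannel_krausMap (by simp [refreshKraus_conjTranspose_mul_self hd])

/-- The channel turns the fresh `ζ` into one more Choi state. The hypothesis is entrywise because
the probe and its partner are separated by the storage. -/
theorem extend_tensorPow_mul_maxEnt
    (Φ : Matrix (Fin d) (Fin d) ℂ →ₗ[ℂ] Matrix (Fin d') (Fin d') ℂ) {k : ℕ}
    {Y : Matrix (Fin d × ParallelAnc d d' k) (Fin d × ParallelAnc d d' k) ℂ}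
    (hY : ∀ p q, Y p q =
      tensorPow (choiState Φ) k p.2.1 q.2.1 * maxEnt d (p.1, p.2.2) (q.1, q.2.2))
    (x y : Fin d' × ParallelAnc d d' k) :
    extend Φ (ParallelAnc d d' k) Y x y =
      tensorPow (choiState Φ) (k + 1) (store d d' k x) (store d d' k y) := by
  have h : (Matrix.of fun i j => Y (i, x.2) (j, y.2)) =
      tensorPow (choiState Φ) k x.2.1 y.2.1 •
        Matrix.of fun i j => maxEnt d (i, x.2.2) (j, y.2.2) := by
    ext i j
    simp [hY]
  rw [extend_apply, h, map_smul]
  exact (tensorPow_succ (choiState Φ) k x.2.1 y.2.1 (x.1, x.2.2) (y.1, y.2.2)).symm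

theorem parallelProtocol_probe (hd : d ≠ 0)
    (Φ : Matrix (Fin d) (Fin d) ℂ →ₗ[ℂ] Matrix (Fin d') (Fin d') ℂ) (k : ℕ)
    (p q : Fin d × ParallelAnc d d' k) :
    (parallelProtocol d d' hd).probe Φ k p q =
      tensorPow (choiState Φ) k p.2.1 q.2.1 * maxEnt d (p.1, p.2.2) (q.1, q.2.2) := by
  induction k with
  | zero =>
    simp only [tensorPow, Matrix.of_apply, Finset.univ_eq_empty, Finset.prod_empty, one_mul]
    rfl
  | succ k ih =>
    change (krausMap (fun _ : Unit => refreshKraus d d' k)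
      (extend Φ (ParallelAnc d d' k) ((parallelProtocol d d' hd).probe Φ k))) p q = _
    simp only [krausMap, LinearMap.coe_mk, AddHom.coe_mk, Finset.univ_unique, Finset.sum_singleton]
    rw [refreshKraus_conj_apply, extend_tensorPow_mul_maxEnt Φ ih]
    simp only [Equiv.apply_symm_apply]

theorem parallelProtocol_output (hd : d ≠ 0)
    (Φ : Matrix (Fin d) (Fin d) ℂ →ₗ[ℂ] Matrix (Fin d') (Fin d') ℂ) (k : ℕ) :
    Matrix.reindex (store d d' k) (store d d' k)
      ((parallelProtocol d d' hd).output Φ (k + 1)) = parallelOutput Φ (k + 1) := by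
  ext f g
  have h := extend_tensorPow_mul_maxEnt Φ (parallelProtocol_probe (d' := d') hd Φ k)
    ((store d d' k).symm f) ((store d d' k).symm g)
  rw [Equiv.apply_symm_apply, Equiv.apply_symm_apply] at h
  rw [parallelOutput_eq_tensorPow]
  exact h

end Parallel

end ChannelUD

end

/-! ### The main theorem -/

theorem corollary1 (d d' m u : ℕ) (hd : 1 ≤ d) (hm : 2 ≤ m) (hu : 1 ≤ u)
    (E : Fin m → (Matrix (Fin d) (Fin d) ℂ →ₗ[ℂ] Matrix (Fin d') (Fin d') ℂ))
    (hE : ∀ n, ChannelUD.IsChannel (E n))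
    (hcov : ChannelUD.JointlyTeleportationCovariant E)
    (P : Fin m → ℝ) (hP : ∀ n, 0 ≤ P n) (hPsum : ∑ n, P n = 1)
    (ε : Fin m → ℝ) (hε : ∀ n, 0 ≤ ε n) (X : ChannelUD.ConstraintKind) :
    -- the two optimal values agree
    ChannelUD.adaptiveOpt X ε E P u =
      ChannelUD.stateOpt X ε (fun n => ChannelUD.tensorPow (ChannelUD.choiState (E n)) u) P ∧
    -- both of them are attained minima
    IsLeast (ChannelUD.adaptiveValues X ε E P u) (ChannelUD.adaptiveOpt X ε E P u) ∧
    IsLeast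
      (ChannelUD.stateValues X ε
        (fun n => ChannelUD.tensorPow (ChannelUD.choiState (E n)) u) P)
      (ChannelUD.stateOpt X ε
        (fun n => ChannelUD.tensorPow (ChannelUD.choiState (E n)) u) P) ∧
    -- the optimum is reached by measuring the outputs of `u` maximally entangled states
    ChannelUD.adaptiveOpt X ε E P u ∈
      ChannelUD.stateValues X ε (fun n => ChannelUD.parallelOutput (E n) u) P ∧
    -- and this non-adaptive strategy is one of the `u`-round protocols
    ∃ (A : ChannelUD.AdaptiveProtocol d d')
      (e : (Fin d' × A.anc (u - 1)) ≃ (Fin u → Fin d' × Fin d)),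
      ∀ Φ : Matrix (Fin d) (Fin d) ℂ →ₗ[ℂ] Matrix (Fin d') (Fin d') ℂ, ChannelUD.IsChannel Φ →
        Matrix.reindex e e (A.output Φ u) = ChannelUD.parallelOutput Φ u := by
  have hd0 : d ≠ 0 := by omega
  have hu0 : u ≠ 0 := by omega
  have hpar : ∃ (A : ChannelUD.AdaptiveProtocol d d')
      (e : (Fin d' × A.anc (u - 1)) ≃ (Fin u → Fin d' × Fin d)),
      ∀ Φ : Matrix (Fin d) (Fin d) ℂ →ₗ[ℂ] Matrix (Fin d') (Fin d') ℂ, ChannelUD.IsChannel Φ →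
        Matrix.reindex e e (A.output Φ u) = ChannelUD.parallelOutput Φ u := by
    obtain ⟨k, rfl⟩ := Nat.exists_eq_succ_of_ne_zero hu0
    exact ⟨ChannelUD.parallelProtocol d d' hd0, ChannelUD.store d d' k,
      fun Φ _ => ChannelUD.parallelProtocol_output hd0 Φ k⟩
  have hvalues : ChannelUD.adaptiveValues X ε E P u =
      ChannelUD.stateValues X ε
        (fun n => ChannelUD.tensorPow (ChannelUD.choiState (E n)) u) P := by
    refine Set.Subset.antisymm ?_ fun p hp => ?_
    · rintro p ⟨A, hA⟩
      exact ChannelUD.stateValues_output_subset hcov hd0 A hu0 X ε P hA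
    · obtain ⟨A, e, h⟩ := hpar
      -- Relabelling the output is itself a channel, so a POVM on the tensor power pulls back to one
      -- on the output of `A`.
      have hR := ChannelUD.isChannel_reindex e
      refine ⟨A, ChannelUD.stateValues_subset_of_map (fun Y hY => hR.posSemidef hY) hR.2
        (fun n => ?_) X ε P hp⟩
      exact (h (E n) (hE n)).trans (ChannelUD.parallelOutput_eq_tensorPow _ _)
  have hleast := ChannelUD.isLeast_stateOpt X hε
    (ρ := fun n => ChannelUD.tensorPow (ChannelUD.choiState (E n)) u)
    (fun n => by
      rw [ChannelUD.trace_tensorPow, ChannelUD.trace_choiState (hE n) hd0, one_pow]) hPsum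
  have hopt : ChannelUD.adaptiveOpt X ε E P u = ChannelUD.stateOpt X ε
      (fun n => ChannelUD.tensorPow (ChannelUD.choiState (E n)) u) P :=
    congrArg sInf hvalues
  refine ⟨hopt, ?_, hleast, ?_, hpar⟩
  · rw [hvalues, hopt]
    exact hleast
  · simp only [ChannelUD.parallelOutput_eq_tensorPow]
    rw [hopt]
    exact hleast.1
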